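/- Let $K$ be a field, $n\ge 5$ and $R=K[X_1,\dots,X_n]$. Consider on $R$ either the multigrading (the $\mathbb Z^n$-grading with $\deg X_i=e_i$, the $i$-th canonical basis vector) or the standard grading (the $\mathbb Z$-grading with $\deg X_i=1$). A graded retract of $R$ is a $K$-subalgebra $S\subseteq R$ for which there is a graded $K$-algebra epimorphism $\pi:R\to S$ with $\pi|_S=\mathrm{id}$; such an $S$ is a polynomial ring over $K$, and its depth is its number of indeterminates, that is, its Krull dimension. A Stanley decomposition of a finitely generated graded $R$-module $M$ is a finite family $(S_i,x_i)_{i\in I}$ of graded retracts $S_i$ of $R$ and homogeneous elements $x_i\in M$ such that $S_i\cap\operatorname{Ann}x_i=0$ for each $i$ and $M=\bigoplus_{i\in I}S_ix_i$ as a graded $K$-vector space. Its depth is the minimum of the depths of the $S_i$, and the Stanley depth $\operatorname{Stdepth}M$ is the maximal depth of a Stanley decomposition of $M$. For $1\le k\le n$ let $M(n,k)$ be the $k$-th syzygy module of $K=R/(X_1,\dots,X_n)$, that is, the image of the differential $$\partial:\bigwedge\nolimits^{k}R^n\to\bigwedge\nolimits^{k-1}R^n,\qquad \partial(e_{i_1}\wedge\dots\wedge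 e_{i_k})=\sum_{j=1}^k(-1)^{j+1}X_{i_j}\,e_{i_1}\wedge\dots\widehat{e_{i_j}}\dots\wedge e_{i_k}$$ of the Koszul complex of $X_1,\dots,X_n$, with the grading in which $e_{i_1}\wedge\dots\wedge e_{i_k}$ ($i_1<\dots<i_k$) has degree $\deg(X_{i_1}\cdots X_{i_k})$. Then $\operatorname{Stdepth}M(n,n-3)=n-1$, both for the multigrading and for the standard grading. -/

import Mathlib

namespace StanleyDepth

/-- The weights of the multigrading on `K[X_1, …, X_n]`: `deg X_i = e_i ∈ ℤⁿ`. -/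
def multiWeight (n : ℕ) : Fin n → (Fin n → ℤ) := fun i => Pi.single i 1

/-- The weights of the standard grading on `K[X_1, …, X_n]`: `deg X_i = 1 ∈ ℤ`. -/
def stdWeight (n : ℕ) : Fin n → ℤ := fun _ => 1

section Decompositions

variable {K : Type*} [Field K] {n : ℕ} {G : Type*} [AddCommGroup G]

/-- A subalgebra `S` of `R = K[X_1, …, X_n]` is a graded retract, for the grading of `R` in which
`X_i` has degree `w i`, if there is a graded epimorphism of `K`-algebras `π : R → S` whose
restriction to `S` is the identity. (`π` is written here as an endomorphism of `R` with
values in `S`.) -/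
def IsGradedRetract (w : Fin n → G) (S : Subalgebra K (MvPolynomial (Fin n) K)) : Prop :=
  ∃ π : MvPolynomial (Fin n) K →ₐ[K] MvPolynomial (Fin n) K,
    (∀ g : G, ∀ f : MvPolynomial (Fin n) K,
      MvPolynomial.IsWeightedHomogeneous w f g → MvPolynomial.IsWeightedHomogeneous w (π f) g) ∧
    (∀ f, π f ∈ S) ∧ ∀ s ∈ S, π s = s

variable {M : Type*} [AddCommGroup M] [Module (MvPolynomial (Fin n) K) M] [Module K M]
  [IsScalarTower K (MvPolynomial (Fin n) K) M]

/-- The `K`-subspace `S x = {s • x | s ∈ S}` of an `R`-module. -/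
noncomputable def stanleySpace (S : Subalgebra K (MvPolynomial (Fin n) K)) (x : M) : Submodule K M :=
  (Subalgebra.toSubmodule S).map
    ((LinearMap.toSpanSingleton (MvPolynomial (Fin n) K) M x).restrictScalars K)

/-- A Stanley decomposition of an `R`-module `M` with homogeneous components `𝓜 g`, where
`R = K[X_1, …, X_n]` is graded by `deg X_i = w i`: a finite family `(S_i, x_i)` of graded retracts
`S_i` of `R` and homogeneous elements `x_i` of `M` with `S_i ∩ Ann x_i = 0` and
`M = ⨁ S_i x_i`. -/
structure StanleyDecomposition (w : Fin n → G) (𝓜 : G → Submodule K M) where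
  /-- the number of summands -/
  len : ℕ
  /-- the retracts -/
  S : Fin len → Subalgebra K (MvPolynomial (Fin n) K)
  /-- the homogeneous elements -/
  x : Fin len → M
  isGradedRetract : ∀ i, IsGradedRetract w (S i)
  homogeneous : ∀ i, ∃ g, x i ∈ 𝓜 g
  ann : ∀ i, ∀ s ∈ S i, s • x i = 0 → s = 0
  isInternal : DirectSum.IsInternal fun i => stanleySpace (S i) (x i)

/-- The depth of a Stanley decomposition. Every graded retract is a polynomial ring over `K`, its
depth is its number of indeterminates, which is its Krull dimension; the depth of the
direct sum is the least one that occurs (and `⊤` for the empty decomposition of the zero module). -/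
noncomputable def StanleyDecomposition.depth {w : Fin n → G} {𝓜 : G → Submodule K M}
    (D : StanleyDecomposition w 𝓜) : WithBot ℕ∞ :=
  ⨅ i, ringKrullDim (D.S i)

/-- The Stanley depth: the maximal depth of a Stanley decomposition
(`⊥` if there is no Stanley decomposition). -/
noncomputable def stanleyDepth (w : Fin n → G) (𝓜 : G → Submodule K M) : WithBot ℕ∞ :=
  ⨆ D : StanleyDecomposition w 𝓜, D.depth

end Decompositions

section Koszul

variable (K : Type*) [Field K] (n : ℕ)

/-- The polynomial ring `R = K[X_1, …, X_n]`. -/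
abbrev R : Type _ := MvPolynomial (Fin n) K

/-- The exterior algebra `⨁_k ⋀^k Rⁿ`, on which the Koszul complex of `X_1, …, X_n` lives. -/
abbrev Koszul : Type _ := ExteriorAlgebra (R K n) (Fin n → R K n)

/-- The differential of the Koszul complex of `X_1, …, X_n`, that is, contraction with the linear
form `Rⁿ → R`, `e_i ↦ X_i`:
`∂(e_{i_1} ∧ ⋯ ∧ e_{i_k}) = ∑_j (-1)^{j+1} X_{i_j} e_{i_1} ∧ ⋯ ê_{i_j} ⋯ ∧ e_{i_k}`. -/
noncomputable def koszulDifferential : Koszul K n →ₗ[R K n] Koszul K n :=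
  CliffordAlgebra.contractLeft
    (Fintype.linearCombination (R K n) (fun i : Fin n => (MvPolynomial.X i : R K n)))

/-- The `k`-th syzygy module `M(n,k)` of `K = R/(X_1, …, X_n)`, for `k ≥ 1`: the image of the
Koszul differential `∂ : ⋀^k Rⁿ → ⋀^{k-1} Rⁿ`. -/
noncomputable def syzygy (k : ℕ) : Submodule (R K n) (Koszul K n) :=
  (⋀[R K n]^k (Fin n → R K n)).map (koszulDifferential K n)

variable {n} {G : Type*} [AddCommGroup G]

/-- The component of degree `g` of the Koszul complex if `deg X_i = w i`: the basis element
`e_{i_1} ∧ ⋯ ∧ e_{i_k}`, `i_1 < ⋯ < i_k`, has degree `w i_1 + ⋯ + w i_k`, so that `v` is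
homogeneous of degree `g` if and only if its coefficient at each basis element `e_F` is a homogeneous
polynomial of degree `g - ∑ i ∈ F, w i`. -/
noncomputable def koszulComponent (w : Fin n → G) (g : G) : Submodule K (Koszul K n) where
  carrier := {v | ∀ F : Finset (Fin n), MvPolynomial.IsWeightedHomogeneous w
    ((Pi.basisFun (R K n) (Fin n)).ExteriorAlgebra.repr v F) (g - ∑ i ∈ F, w i)}
  add_mem' := fun {u v} hu hv F => by
    rw [map_add, Finsupp.add_apply]
    exact (hu F).add (hv F)
  zero_mem' := fun F => by
    rw [map_zero, Finsupp.zero_apply]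
    exact MvPolynomial.isWeightedHomogeneous_zero K w _
  smul_mem' := fun c v hv F => by
    rw [← algebraMap_smul (R K n) c v, map_smul, Finsupp.smul_apply, algebraMap_smul]
    exact (MvPolynomial.weightedHomogeneousSubmodule K w _).smul_mem c (hv F)

/-- The grading of `M(n,k)`, inherited from the Koszul complex. -/
noncomputable def syzygyComponent (w : Fin n → G) (k : ℕ) (g : G) : Submodule K (syzygy K n k) :=
  (koszulComponent K w g).comap ((syzygy K n k).subtype.restrictScalars K)

end Koszul

end StanleyDepth

/-! Upper bound: if every retract of a Stanley decomposition were `R`, its elements would form an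
`R`-basis, but `M(n,k)` is not free for `0 < k < n` (`exists_retract_ne_top`). A proper graded
retract is a quotient of `R` by a nonzero ideal, so its dimension is at most `n - 1`.

Lower bound: up to a monomial factor, the component of `M(n,k)` in a multidegree with support `A`
depends only on `A`; it is `boundarySpan K k A`. A space `K[X_i : i ∈ T] x`, with `x` of squarefree
degree `F ⊆ T`, meets it exactly when `F ⊆ A ⊆ T`. So a decomposition amounts to intervals `[F, T]`
with vectors such that, for each `A`, the vectors active at `A` form a basis of `boundarySpan K k A`
(`exists_stanleyDecomposition`).

For `k = n - 3`, a generator `∂ e_H` corresponds to the triangle `Hᶜ`. Map the edges of the complete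
graph on `n` vertices injectively to triangles containing them, `{i, j} ↦ {i, j, apex i j}`;
counting shows that this needs `n ≥ 5`. Let `∂ e_H` carry all variables except the apex of `Hᶜ`, if
there is one. At most one variable is lost.

Independence at `A`: the coordinate of a relation at the complement of a tetrahedron involves only
its four faces, each with coefficient ±1, so a face has coefficient zero once the other three do.
With `D = Aᶜ`, the coefficients vanish from the outset on triangles that do not contain `D` or have
an apex outside `D`, and these generate all triangles (`triangle_induction`). For `|A| ≤ n - 2` the
active vectors also span (`boundarySpan_le`). In larger degrees whatever is missing is added with
retract `K[X_i : i ∈ A]`, of depth at least `n - 1`. -/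

namespace StanleyDepth

open MvPolynomial

/-! ### The Koszul complex in multigraded coordinates -/

section Coordinates

variable (K : Type*) [Field K] {n : ℕ}

/-- The basis element `e_F` of the Koszul complex. -/
noncomputable abbrev koszulBasis (F : Finset (Fin n)) : Koszul K n :=
  (Pi.basisFun (R K n) (Fin n)).ExteriorAlgebra F

lemma koszulBasis_empty : koszulBasis K (∅ : Finset (Fin n)) = 1 := by
  rw [koszulBasis, ExteriorAlgebra.basis_apply_ofCard _ (n := 0) (by simp)]
  simp [ExteriorAlgebra.ιMulti_family]

lemma koszulBasis_singleton (i : Fin n) :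
    koszulBasis K {i} = ExteriorAlgebra.ι (R K n) (Pi.basisFun (R K n) (Fin n) i) := by
  rw [koszulBasis, ExteriorAlgebra.basis_apply_ofCard _ (n := 1) (by simp),
    ExteriorAlgebra.ιMulti_family, ExteriorAlgebra.ιMulti_apply]
  simp only [List.ofFn_succ, List.ofFn_zero, List.prod_cons, List.prod_nil, mul_one]
  congr 2
  rw [Function.comp_apply]
  congr 1
  have h := (Set.powersetCard.mem_range_ofFinEmbEquiv_symm_iff_mem
    (Set.powersetCard.ofCard (s := ({i} : Finset (Fin n))) (n := 1) (by simp)) _).1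
    (Set.mem_range_self 0)
  exact Finset.mem_singleton.1 h

lemma ι_mul_koszulBasis {i : Fin n} {F : Finset (Fin n)} (hi : i ∉ F) :
    ∃ u : ℤˣ, ExteriorAlgebra.ι (R K n) (Pi.basisFun (R K n) (Fin n) i) * koszulBasis K F =
      u • koszulBasis K (insert i F) := by
  have h := ExteriorAlgebra.basis_mul_of_disjoint (Pi.basisFun (R K n) (Fin n))
    (Set.powersetCard.ofCard (s := {i}) (n := 1) (by simp))
    (Set.powersetCard.ofCard (s := F) rfl) (by simpa using hi)
  rw [← koszulBasis_singleton]
  refine ⟨_, h.trans (congrArg _ (congrArg (koszulBasis K) ?_))⟩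
  ext j
  simp

/-- The Koszul differential of a basis element. -/
lemma koszulDifferential_koszulBasis (F : Finset (Fin n)) :
    ∃ u : Fin n → ℤˣ, koszulDifferential K n (koszulBasis K F) =
      ∑ i ∈ F, u i • (X i : R K n) • koszulBasis K (F.erase i) := by
  induction F using Finset.induction_on with
  | empty =>
    refine ⟨1, ?_⟩
    rw [koszulBasis_empty, koszulDifferential]
    exact CliffordAlgebra.contractLeft_one _ _
  | insert a F ha ih =>
    obtain ⟨s, hs⟩ := ih
    obtain ⟨u, hu⟩ := ι_mul_koszulBasis K ha
    have hu' : koszulBasis K (insert a F) = u⁻¹ •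
        (ExteriorAlgebra.ι (R K n) (Pi.basisFun (R K n) (Fin n) a) * koszulBasis K F) := by
      rw [hu, inv_smul_smul]
    have hc : ∀ i ∈ F, ∃ v : ℤˣ, ExteriorAlgebra.ι (R K n) (Pi.basisFun (R K n) (Fin n) a) *
        koszulBasis K (F.erase i) = v • koszulBasis K ((insert a F).erase i) := by
      intro i hi
      obtain ⟨v, hv⟩ := ι_mul_koszulBasis K (i := a) (F := F.erase i) (by simp [ha])
      refine ⟨v, hv.trans ?_⟩
      rw [Finset.erase_insert_of_ne (by rintro rfl; exact ha hi)]
    choose! v hv using hc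
    have hX : Fintype.linearCombination (R K n) (fun i : Fin n => (X i : R K n))
        (Pi.basisFun (R K n) (Fin n) a) = X a := by
      simp
    refine ⟨fun i => if i = a then u⁻¹ else -(u⁻¹ * s i * v i), ?_⟩
    rw [Finset.sum_insert ha, hu', Finset.erase_insert ha]
    beta_reduce
    rw [if_pos rfl]
    have h1 : koszulDifferential K n
        (ExteriorAlgebra.ι (R K n) (Pi.basisFun (R K n) (Fin n) a) * koszulBasis K F) =
        (X a : R K n) • koszulBasis K F -
        ExteriorAlgebra.ι (R K n) (Pi.basisFun (R K n) (Fin n) a) *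
          koszulDifferential K n (koszulBasis K F) := by
      rw [koszulDifferential]
      refine (CliffordAlgebra.contractLeft_ι_mul _ _ _).trans ?_
      rw [hX]
    rw [Units.smul_def, map_zsmul, h1, hs, ← Units.smul_def, smul_sub, sub_eq_add_neg,
      Finset.mul_sum, Finset.smul_sum, ← Finset.sum_neg_distrib]
    congr 1
    refine Finset.sum_congr rfl fun i hi => ?_
    rw [if_neg (by rintro rfl; exact ha hi), mul_smul_comm, mul_smul_comm, hv i hi]
    rw [Units.neg_smul, mul_smul, mul_smul, smul_comm (X i : R K n) (v i)]

variable {K}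

/-- The exponent vector of the squarefree monomial `∏ i ∈ F, X i`. -/
noncomputable def expo (F : Finset (Fin n)) : Fin n →₀ ℕ := ∑ i ∈ F, Finsupp.single i 1

lemma expo_apply (F : Finset (Fin n)) (i : Fin n) : expo F i = if i ∈ F then 1 else 0 := by
  simp [expo, Finsupp.single_apply]

lemma expo_injective : Function.Injective (expo (n := n)) := by
  intro F H h
  ext i
  have := DFunLike.congr_fun h i
  rw [expo_apply, expo_apply] at this
  split_ifs at this <;> simp_all

lemma expo_erase {F : Finset (Fin n)} {i : Fin n} (hi : i ∈ F) :
    Finsupp.single i 1 + expo (F.erase i) = expo F :=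
  Finset.add_sum_erase F (fun i => Finsupp.single i 1) hi

variable (K) in
/-- The coordinates of an element of the Koszul complex, the coordinate at `e_F` being multiplied
by `∏ i ∈ F, X i`. -/
noncomputable def twist : Koszul K n →ₗ[R K n] (Finset (Fin n) → R K n) :=
  LinearMap.pi fun F => (monomial (expo F) (1 : K)) •
    (Finsupp.lapply F ∘ₗ (Pi.basisFun (R K n) (Fin n)).ExteriorAlgebra.repr.toLinearMap)

lemma twist_apply (v : Koszul K n) (F : Finset (Fin n)) :
    twist K v F = monomial (expo F) 1 * (Pi.basisFun (R K n) (Fin n)).ExteriorAlgebra.repr v F :=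
  rfl

lemma twist_injective : Function.Injective (twist K (n := n)) := by
  rw [← LinearMap.ker_eq_bot, LinearMap.ker_eq_bot']
  intro v hv
  have h : (Pi.basisFun (R K n) (Fin n)).ExteriorAlgebra.repr v = 0 := by
    ext1 F
    have := congrFun hv F
    rw [twist_apply] at this
    simpa using this
  simpa using h

lemma twist_koszulBasis (F H : Finset (Fin n)) :
    twist K (koszulBasis K F) H = if F = H then monomial (expo F) 1 else 0 := by
  rw [twist_apply, koszulBasis, Module.Basis.repr_self, Finsupp.single_apply]
  split_ifs with h
  · rw [h, mul_one]
  · rw [mul_zero]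

variable (K) in
/-- The coefficient vector of the image of `e_F` under the Koszul differential. -/
noncomputable def boundary (F H : Finset (Fin n)) : K :=
  coeff (expo F) (twist K (koszulDifferential K n (koszulBasis K F)) H)

lemma exists_boundary_eq (F : Finset (Fin n)) : ∃ u : Fin n → ℤˣ, ∀ H,
    boundary K F H = (∑ i ∈ F, if F.erase i = H then (((u i : ℤˣ) : ℤ) : K) else 0) ∧
    twist K (koszulDifferential K n (koszulBasis K F)) H = monomial (expo F) (boundary K F H) := by
  obtain ⟨u, hu⟩ := koszulDifferential_koszulBasis K F
  have key : ∀ H, twist K (koszulDifferential K n (koszulBasis K F)) H = monomial (expo F)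
      (∑ i ∈ F, if F.erase i = H then (((u i : ℤˣ) : ℤ) : K) else 0) := by
    intro H
    rw [hu, map_sum, Finset.sum_apply, map_sum]
    refine Finset.sum_congr rfl fun i hi => ?_
    rw [Units.smul_def, map_zsmul, map_smul, Pi.smul_apply, Pi.smul_apply, twist_koszulBasis]
    split_ifs with h
    · rw [smul_eq_mul, X, monomial_mul, expo_erase hi, one_mul, ← map_zsmul, zsmul_eq_mul, mul_one]
    · simp
  refine ⟨u, fun H => ?_⟩
  have h : boundary K F H = ∑ i ∈ F, if F.erase i = H then (((u i : ℤˣ) : ℤ) : K) else 0 := by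
    rw [boundary, key, coeff_monomial, if_pos rfl]
  exact ⟨h, h ▸ key H⟩

lemma twist_koszulDifferential (F H : Finset (Fin n)) :
    twist K (koszulDifferential K n (koszulBasis K F)) H = monomial (expo F) (boundary K F H) :=
  ((exists_boundary_eq F).choose_spec H).2

lemma boundary_eq_zero {F H : Finset (Fin n)} (h : ∀ i ∈ F, F.erase i ≠ H) :
    boundary K F H = 0 := by
  obtain ⟨u, hu⟩ := exists_boundary_eq (K := K) F
  rw [(hu H).1]
  exact Finset.sum_eq_zero fun i hi => if_neg (h i hi)

/-- Distinct vertices of `F` give distinct faces, so a single sign survives; it is nonzero in every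
characteristic. The precise signs are never needed. -/
lemma boundary_erase_ne_zero {F : Finset (Fin n)} {i : Fin n} (hi : i ∈ F) :
    boundary K F (F.erase i) ≠ 0 := by
  obtain ⟨u, hu⟩ := exists_boundary_eq (K := K) F
  rw [(hu _).1, Finset.sum_eq_single_of_mem i hi, if_pos rfl]
  · exact ((u i).isUnit.map (Int.castRingHom K)).ne_zero
  · intro j hj hji
    refine if_neg fun h => ?_
    have : j ∈ F.erase i := Finset.mem_erase.2 ⟨hji, hj⟩
    rw [← h] at this
    simp at this

/-- The relation between boundaries which expresses that the square of the Koszul differential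
is zero. -/
lemma exists_sum_boundary_eq_zero (A : Finset (Fin n)) : ∃ u : Fin n → ℤˣ,
    ∑ i ∈ A, u i • (X i : R K n) • koszulDifferential K n (koszulBasis K (A.erase i)) = 0 ∧
    ∑ i ∈ A, (((u i : ℤˣ) : ℤ) : K) • boundary K (A.erase i) = 0 := by
  obtain ⟨u, hu⟩ := koszulDifferential_koszulBasis K A
  have h : ∑ i ∈ A, u i • (X i : R K n) • koszulDifferential K n (koszulBasis K (A.erase i)) =
      0 := by
    have h0 : koszulDifferential K n (koszulDifferential K n (koszulBasis K A)) = 0 :=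
      CliffordAlgebra.contractLeft_contractLeft _ _
    rw [hu, map_sum] at h0
    simpa only [Units.smul_def, map_zsmul, map_smul] using h0
  refine ⟨u, h, funext fun H => ?_⟩
  have h1 := congrArg (coeff (expo A)) (congrFun (congrArg (twist K) h) H)
  rw [map_sum, Finset.sum_apply, coeff_sum] at h1
  rw [Finset.sum_apply]
  refine Eq.trans (Finset.sum_congr rfl fun i hi => ?_) (h1.trans (by simp))
  rw [Units.smul_def, map_zsmul, map_smul, Pi.smul_apply, Pi.smul_apply, Pi.smul_apply, twist_koszulDifferential,
    smul_eq_mul, smul_eq_mul, X, monomial_mul, expo_erase hi, one_mul, ← map_zsmul,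
    coeff_monomial, if_pos rfl, zsmul_eq_mul]

end Coordinates

/-! ### Polynomial subrings as graded retracts -/

section Retract

variable {K : Type*} [Field K] {n : ℕ} {G : Type*} [AddCommGroup G]

lemma isGradedRetract_supported (w : Fin n → G) (s : Finset (Fin n)) :
    IsGradedRetract w (supported K (s : Set (Fin n))) := by
  classical
  refine ⟨aeval fun i => if i ∈ s then X i else 0, fun g f hf => ?_, fun f => ?_, fun f hf => ?_⟩
  · rw [aeval_def, eval₂_eq']
    refine IsWeightedHomogeneous.sum _ _ _ fun d hd => ?_
    have hd' := hf (mem_support_iff.1 hd)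
    by_cases h : ∀ i, d i ≠ 0 → i ∈ s
    · have : (∏ i, (if i ∈ s then X i else 0 : R K n) ^ d i) = monomial d 1 := by
        rw [monomial_eq, map_one, one_mul, Finsupp.prod_fintype _ _ (fun _ => pow_zero _)]
        refine Finset.prod_congr rfl fun i _ => ?_
        by_cases hi : d i = 0
        · rw [hi, pow_zero, pow_zero]
        · rw [if_pos (h i hi)]
      rw [this, algebraMap_eq, C_mul_monomial]
      exact isWeightedHomogeneous_monomial _ _ _ hd'
    · push Not at h
      obtain ⟨i, hi, his⟩ := h
      rw [Finset.prod_eq_zero (Finset.mem_univ i) (by rw [if_neg his, zero_pow hi]), mul_zero]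
      exact isWeightedHomogeneous_zero _ _ _
  · refine (Algebra.adjoin_le ?_ : Algebra.adjoin K (Set.range fun i : Fin n =>
      (if i ∈ s then X i else 0 : R K n)) ≤ supported K (s : Set (Fin n))) ?_
    · rintro _ ⟨i, rfl⟩
      dsimp only
      split_ifs with hi
      · exact X_mem_supported.2 hi
      · exact zero_mem _
    · rw [Algebra.adjoin_range_eq_range_aeval]
      exact ⟨f, rfl⟩
  · rw [supported_eq_adjoin_X] at hf
    refine Algebra.adjoin_induction (p := fun f _ =>
      aeval (fun i => if i ∈ s then (X i : R K n) else 0) f = f) ?_ ?_ ?_ ?_ hf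
    · rintro _ ⟨i, hi, rfl⟩
      rw [aeval_X, if_pos (by exact hi)]
    · intro r
      exact AlgHom.commutes _ r
    · intro f g _ _ hf hg
      rw [map_add, hf, hg]
    · intro f g _ _ hf hg
      rw [map_mul, hf, hg]

lemma ringKrullDim_supported (s : Finset (Fin n)) :
    ringKrullDim (supported K (s : Set (Fin n))) = (s.card : WithBot ℕ∞) := by
  rw [ringKrullDim_eq_of_ringEquiv (supportedEquivMvPolynomial (s : Set (Fin n))).toRingEquiv,
    MvPolynomial.ringKrullDim_of_isNoetherianRing, ringKrullDim_eq_zero_of_field, zero_add]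
  simp

lemma mem_stanleySpace {M : Type*} [AddCommGroup M] [Module (R K n) M] [Module K M]
    [IsScalarTower K (R K n) M] {S : Subalgebra K (R K n)} {x y : M} :
    y ∈ stanleySpace S x ↔ ∃ s ∈ S, s • x = y := by
  simp [stanleySpace]

end Retract

/-! ### Elements of squarefree multidegree -/

section Pure

variable {K : Type*} [Field K] {n : ℕ}

lemma koszulBasis_mem {k : ℕ} {F : Finset (Fin n)} (hF : F.card = k) :
    koszulBasis K F ∈ ⋀[R K n]^k (Fin n → R K n) := by
  have h := ExteriorAlgebra.basis_eq_coe_basis (Pi.basisFun (R K n) (Fin n))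
    (Set.powersetCard.ofCard hF)
  rw [Set.powersetCard.val_ofCard] at h
  rw [koszulBasis, h]
  exact Subtype.property _

lemma syzygy_eq_span (k : ℕ) : syzygy K n k = Submodule.span (R K n)
    ((fun F => koszulDifferential K n (koszulBasis K F)) '' {F | F.card = k}) := by
  have h : ⋀[R K n]^k (Fin n → R K n) =
      Submodule.span (R K n) (koszulBasis K '' {F : Finset (Fin n) | F.card = k}) := by
    apply le_antisymm
    · intro v hv
      have h1 := ((Pi.basisFun (R K n) (Fin n)).exteriorPower k).mem_span ⟨v, hv⟩
      have h2 := Submodule.mem_map_of_mem (f := Submodule.subtype _) h1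
      rw [Submodule.map_span] at h2
      refine Submodule.span_mono ?_ h2
      rintro _ ⟨_, ⟨s, rfl⟩, rfl⟩
      exact ⟨s.1, s.2, ExteriorAlgebra.basis_eq_coe_basis _ s⟩
    · rw [Submodule.span_le]
      rintro _ ⟨F, hF, rfl⟩
      exact koszulBasis_mem hF
  rw [syzygy, h, Submodule.map_span, Set.image_image]

lemma koszulDifferential_mem_syzygy {k : ℕ} {F : Finset (Fin n)} (hF : F.card = k) :
    koszulDifferential K n (koszulBasis K F) ∈ syzygy K n k :=
  Submodule.mem_map_of_mem (koszulBasis_mem hF)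

/-- The element `x` of the Koszul complex is homogeneous, its multidegree is the indicator
vector of `A`, and its coefficient vector is `ξ`. -/
def IsPure (A : Finset (Fin n)) (ξ : Finset (Fin n) → K) (x : Koszul K n) : Prop :=
  ∀ H, twist K x H = monomial (expo A) (ξ H)

variable (K) in
/-- The space of coefficient vectors of the elements of the `k`-th syzygy module whose
multidegree is the indicator vector of `A`. -/
def boundarySpan (k : ℕ) (A : Finset (Fin n)) : Submodule K (Finset (Fin n) → K) :=
  Submodule.span K (boundary K '' {F | F.card = k ∧ F ⊆ A})

lemma expo_sdiff_add {F A : Finset (Fin n)} (h : F ⊆ A) : expo (A \ F) + expo F = expo A :=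
  Finset.sum_sdiff h

lemma exists_isPure {k : ℕ} {A : Finset (Fin n)} {ξ : Finset (Fin n) → K}
    (hξ : ξ ∈ boundarySpan K k A) : ∃ x : syzygy K n k, IsPure A ξ x := by
  induction hξ using Submodule.span_induction with
  | mem ξ h =>
    obtain ⟨F, ⟨hF, hFA⟩, rfl⟩ := h
    refine ⟨(monomial (expo (A \ F)) 1 : R K n) • ⟨_, koszulDifferential_mem_syzygy hF⟩,
      fun H => ?_⟩
    rw [Submodule.coe_smul, map_smul, Pi.smul_apply, twist_koszulDifferential, smul_eq_mul,
      monomial_mul, expo_sdiff_add hFA, one_mul]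
  | zero => exact ⟨0, fun H => by simp⟩
  | add ξ η _ _ hx hy =>
    obtain ⟨x, hx⟩ := hx
    obtain ⟨y, hy⟩ := hy
    exact ⟨x + y, fun H => by rw [Submodule.coe_add, map_add, Pi.add_apply, hx, hy, Pi.add_apply,
      map_add]⟩
  | smul c ξ _ hx =>
    obtain ⟨x, hx⟩ := hx
    refine ⟨c • x, fun H => ?_⟩
    rw [Submodule.coe_smul_of_tower, LinearMap.map_smul_of_tower, Pi.smul_apply, hx, Pi.smul_apply,
      map_smul]

variable {G : Type*} [AddCommGroup G]

lemma weight_expo (w : Fin n → G) (F : Finset (Fin n)) :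
    Finsupp.weight w (expo F) = ∑ i ∈ F, w i := by
  rw [expo, map_sum]
  simp [Finsupp.weight_single]

/-- The weight is arbitrary, so a construction from pure elements serves the multigrading and the
standard grading at once. -/
lemma IsPure.mem_koszulComponent (w : Fin n → G) {A : Finset (Fin n)} {ξ : Finset (Fin n) → K}
    {x : Koszul K n} (hx : IsPure A ξ x) : x ∈ koszulComponent K w (∑ i ∈ A, w i) := by
  intro F d hd
  have h := congrArg (coeff (expo F + d)) (hx F)
  rw [twist_apply, coeff_monomial_mul, one_mul, coeff_monomial] at h
  split_ifs at h with h'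
  · rw [← weight_expo, h', map_add, weight_expo, add_sub_cancel_left]
  · exact absurd h hd

end Pure

/-! ### Stanley decompositions from linear algebra on supports -/

section Decomposition

variable {K : Type*} [Field K] {n k : ℕ} {ι : Type*} [Fintype ι]
  {F T : ι → Finset (Fin n)} {ξ : ι → Finset (Fin n) → K} {x : ι → syzygy K n k}

/-- A relation splits by multidegree. In a degree with support `A` it becomes a linear relation
among the vectors active at `A`. -/
lemma eq_zero_of_sum_smul_eq_zero (hx : ∀ i, IsPure (F i) (ξ i) (x i : Koszul K n))
    (hli : ∀ (A : Finset (Fin n)) (c : ι → K), (∀ i, ¬(F i ⊆ A ∧ A ⊆ T i) → c i = 0) →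
      ∑ i, c i • ξ i = 0 → c = 0)
    (hFT : ∀ i, F i ⊆ T i) (s : ι → R K n) (hs : ∀ i, s i ∈ supported K (T i : Set (Fin n)))
    (h : ∑ i, s i • x i = 0) : s = 0 := by
  funext i
  ext m
  -- The coefficient of `s i` at `m` lands in multidegree `m + expo (F i)`; the scalars collect the
  -- coefficients of all `s j` landing there.
  have hc := hli (m + expo (F i)).support
    (fun j => if expo (F j) ≤ m + expo (F i) then coeff (m + expo (F i) - expo (F j)) (s j) else 0)
    ?_ ?_
  · have := congrFun hc i
    simpa using this
  · intro j hj
    split_ifs with hle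
    · by_contra hne
      refine hj ⟨fun a ha => ?_, fun a ha => ?_⟩
      · have := hle a
        rw [expo_apply, if_pos ha] at this
        rw [Finsupp.mem_support_iff]
        omega
      · by_cases haF : a ∈ F j
        · exact hFT j haF
        · rw [Finsupp.mem_support_iff] at ha
          refine mem_supported.1 (hs j) ?_
          refine (mem_vars_iff_mem_support _).2 ⟨_, mem_support_iff.2 hne, ?_⟩
          rw [Finsupp.mem_support_iff, Finsupp.tsub_apply, expo_apply (F j), if_neg haF]
          exact ha
    · rfl
  · funext H
    have h1 := congrArg (fun y : syzygy K n k => coeff (m + expo (F i)) (twist K (y : Koszul K n) H)) h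
    rw [Submodule.coe_sum, map_sum, Finset.sum_apply, coeff_sum] at h1
    rw [Finset.sum_apply]
    refine Eq.trans (Finset.sum_congr rfl fun j _ => ?_) (h1.trans (by simp))
    rw [Submodule.coe_smul, map_smul, Pi.smul_apply, Pi.smul_apply, hx, smul_eq_mul, smul_eq_mul,
      coeff_mul_monomial']
    split_ifs <;> simp

/-- It suffices to treat monomial multiples of the generators; these are expanded in the vectors
active at their support. -/
lemma mem_iSup_stanleySpace (hx : ∀ i, IsPure (F i) (ξ i) (x i : Koszul K n))
    (hsp : ∀ A H : Finset (Fin n), H.card = k → H ⊆ A → ∃ c : ι → K,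
      (∀ i, ¬(F i ⊆ A ∧ A ⊆ T i) → c i = 0) ∧ boundary K H = ∑ i, c i • ξ i) (y : syzygy K n k) :
    y ∈ ⨆ i, stanleySpace (supported K (T i : Set (Fin n))) (x i) := by
  have key : ∀ (H : Finset (Fin n)) (hH : H.card = k) (p : R K n),
      p • (⟨_, koszulDifferential_mem_syzygy hH⟩ : syzygy K n k) ∈
        ⨆ i, stanleySpace (supported K (T i : Set (Fin n))) (x i) := by
    intro H hH p
    induction p using MvPolynomial.induction_on' with
    | add p q hp hq => rw [add_smul]; exact add_mem hp hq
    | monomial m a =>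
      obtain ⟨c, hc, hβ⟩ := hsp (m + expo H).support H hH (fun i hi => by
        rw [Finsupp.mem_support_iff, Finsupp.add_apply, expo_apply, if_pos hi]; omega)
      have : (monomial m a : R K n) • (⟨_, koszulDifferential_mem_syzygy hH⟩ : syzygy K n k) =
          ∑ i, (monomial (m + expo H - expo (F i)) (a * c i) : R K n) • x i := by
        apply Subtype.ext
        apply twist_injective
        funext L
        rw [Submodule.coe_smul, map_smul, Pi.smul_apply, twist_koszulDifferential,
          Submodule.coe_sum, map_sum, Finset.sum_apply, smul_eq_mul, monomial_mul, hβ,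
          Finset.sum_apply, Finset.mul_sum, map_sum]
        refine Finset.sum_congr rfl fun i _ => ?_
        rw [Submodule.coe_smul, map_smul, Pi.smul_apply, Pi.smul_apply, hx, smul_eq_mul,
          smul_eq_mul, monomial_mul, mul_assoc]
        by_cases hi : F i ⊆ (m + expo H).support ∧ (m + expo H).support ⊆ T i
        · rw [tsub_add_cancel_of_le]
          intro j
          rw [expo_apply]
          split_ifs with hj
          · exact Nat.one_le_iff_ne_zero.2 (Finsupp.mem_support_iff.1 (hi.1 hj))
          · exact Nat.zero_le _
        · simp [hc i hi]
      rw [this]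
      refine sum_mem fun i _ => ?_
      by_cases hi : F i ⊆ (m + expo H).support ∧ (m + expo H).support ⊆ T i
      · refine Submodule.mem_iSup_of_mem i (mem_stanleySpace.2 ⟨_, ?_, rfl⟩)
        refine mem_supported.2 fun j hj => hi.2 ?_
        obtain ⟨d, hd, hjd⟩ := (mem_vars_iff_mem_support _).1 hj
        have := support_monomial_subset hd
        rw [Finset.mem_singleton] at this
        subst this
        rw [Finsupp.mem_support_iff, Finsupp.tsub_apply] at hjd
        rw [Finsupp.mem_support_iff]
        omega
      · rw [hc i hi, mul_zero, map_zero, zero_smul]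
        exact zero_mem _
  obtain ⟨y, hy⟩ := y
  have hy' := hy
  rw [syzygy_eq_span, Submodule.mem_span_image_iff_exists_fun] at hy'
  obtain ⟨t, ht, c, hc⟩ := hy'
  have ht' : ∀ i : t, (i : Finset (Fin n)).card = k := fun i => ht i.2
  have : (⟨y, hy⟩ : syzygy K n k) = ∑ i : t, c i • ⟨_, koszulDifferential_mem_syzygy (ht' i)⟩ :=
    Subtype.ext (hc.symm.trans (by rw [Submodule.coe_sum]; rfl))
  rw [this]
  exact sum_mem fun i _ => key _ (ht' i) _

lemma exists_stanleyDecomposition {G : Type*} [AddCommGroup G] (w : Fin n → G)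
    (hξ : ∀ i, ξ i ∈ boundarySpan K k (F i))
    (hli : ∀ (A : Finset (Fin n)) (c : ι → K), (∀ i, ¬(F i ⊆ A ∧ A ⊆ T i) → c i = 0) →
      ∑ i, c i • ξ i = 0 → c = 0)
    (hsp : ∀ A H : Finset (Fin n), H.card = k → H ⊆ A → ∃ c : ι → K,
      (∀ i, ¬(F i ⊆ A ∧ A ⊆ T i) → c i = 0) ∧ boundary K H = ∑ i, c i • ξ i)
    (hFT : ∀ i, F i ⊆ T i) :
    ∃ D : StanleyDecomposition w (syzygyComponent K w k),
      ∀ i, ∃ j, D.S i = supported K (T j : Set (Fin n)) := by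
  classical
  choose x hx using fun i => exists_isPure (hξ i)
  have hli' := eq_zero_of_sum_smul_eq_zero hx hli hFT
  have hind : iSupIndep fun i => stanleySpace (supported K (T i : Set (Fin n))) (x i) := by
    rw [iSupIndep_iff_finsetSum_eq_zero_imp_eq_zero]
    intro t y hy h i hi
    choose! s hs hsy using fun i (hi : i ∈ t) => mem_stanleySpace.1 (hy i hi)
    have := hli' (fun j => if j ∈ t then s j else 0) (fun j => by
      split_ifs with hj
      · exact hs j hj
      · exact zero_mem _) (by
      rw [← h, ← Finset.sum_subset (Finset.subset_univ t)
        (fun j _ hj => by rw [if_neg hj, zero_smul])]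
      exact Finset.sum_congr rfl fun j hj => by rw [if_pos hj, hsy j hj])
    have h2 := congrFun this i
    rw [if_pos hi] at h2
    rw [← hsy i hi, h2, Pi.zero_apply, zero_smul]
  let e := (Fintype.equivFin ι).symm
  refine ⟨⟨Fintype.card ι, fun i => supported K (T (e i) : Set (Fin n)), fun i => x (e i),
    fun i => isGradedRetract_supported w _, fun i => ⟨_, (hx (e i)).mem_koszulComponent w⟩,
    fun i s hs h => ?_, ?_⟩, fun i => ⟨e i, rfl⟩⟩
  · have := hli' (Pi.single (e i) s) (fun j => by
      rw [Pi.single_apply]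
      split_ifs with hj
      · exact hj ▸ hs
      · exact zero_mem _) (by
      rw [Finset.sum_eq_single (e i) (fun j _ hj => by rw [Pi.single_eq_of_ne hj, zero_smul])
        (by simp), Pi.single_eq_same, h])
    simpa using congrFun this (e i)
  · refine DirectSum.isInternal_submodule_of_iSupIndep_of_iSup_eq_top
      (hind.comp e.injective) ?_
    rw [e.iSup_comp (g := fun i => stanleySpace (supported K (T i : Set (Fin n))) (x i)), eq_top_iff]
    exact fun y _ => mem_iSup_stanleySpace hx hsp y

end Decomposition

/-! ### An injection from edges to triangles -/

section Apex

/-- For `i < j` a third vertex; the triangles `{i, j, apexAux i j}` are pairwise distinct. -/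
def apexAux (i j : ℕ) : ℕ :=
  -- The triangles with largest vertex `j ≥ 5` form the cone from `j` over the cycle `0, 1, …, j -
  -- 1`.
  if 5 ≤ j then (if i + 1 < j then i + 1 else 0)
  -- View `0, …, 4` as the vertices of a regular pentagon: the apex is the vertex equidistant from
  -- `i` and `j`. Every three vertices form an isosceles triangle with a unique base, so edges and
  -- triangles correspond bijectively.
  else if j = i + 1 then (i + 3) % 5
  else if j = i + 2 then i + 1
  else if j = i + 3 then (j + 1) % 5
  else 2

/-- The symmetric form of `apexAux`. -/
def apex (i j : ℕ) : ℕ := apexAux (min i j) (max i j)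

lemma apex_comm (i j : ℕ) : apex i j = apex j i := by
  rw [apex, apex, min_comm, max_comm]

lemma apex_ne_left {i j : ℕ} (h : i ≠ j) : apex i j ≠ i := by
  rcases le_total i j with h' | h' <;>
  · simp only [apex, apexAux, min_eq_left h', max_eq_right h', min_eq_right h', max_eq_left h']
    split_ifs <;> omega

lemma apex_lt {i j n : ℕ} (hn : 5 ≤ n) (hi : i < n) (hj : j < n) : apex i j < n := by
  rcases le_total i j with h' | h' <;>
  · simp only [apex, apexAux, min_eq_left h', max_eq_right h', min_eq_right h', max_eq_left h']
    split_ifs <;> omega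

/-- Otherwise one triangle would come from two of its edges; this is the injectivity of the
assignment. -/
lemma apex_inj {a b c : ℕ} (hbc : b ≠ c) (h : apex a b = c) :
    apex a c ≠ b := by
  intro h2
  simp only [apex, apexAux] at h h2
  rcases le_total a b with h' | h' <;> rcases le_total a c with h'' | h'' <;>
    simp only [min_eq_left h', max_eq_right h', min_eq_right h', max_eq_left h', min_eq_left h'',
      max_eq_right h'', min_eq_right h'', max_eq_left h''] at h h2 <;>
    split_ifs at h h2 <;> omega

variable {n : ℕ}

/-- Connectedness of the graph on the vertices other than `v` with edges `{a, apex a v}`: every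
vertex is linked to a root, `0` or, if `v = 0`, `1`. -/
lemma apex_connected {r : ℕ → ℕ → Prop} {v : ℕ} (hn : 5 ≤ n) (hv : v < n) (hsymm : ∀ a b, r a b → r b a)
    (hrefl : ∀ a, r a a)
    (htrans : ∀ a b c, a < n → b < n → c < n → a ≠ v → b ≠ v → c ≠ v → r a b → r b c → r a c)
    (hr : ∀ a, a < n → a ≠ v → r a (apex a v)) {a b : ℕ} (ha : a < n) (hb : b < n) (hav : a ≠ v)
    (hbv : b ≠ v) : r a b := by
  have key : ∀ a, a < n → a ≠ v → r a (if v = 0 then 1 else 0) := by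
    intro a
    induction a using Nat.strong_induction_on with
    | _ a ih =>
    intro ha hav
    have step : ∀ b, b < a → b ≠ v → r a b → r a (if v = 0 then 1 else 0) := fun b hba hbv hab =>
      htrans a b _ ha (hba.trans ha) (by split_ifs <;> omega) hav hbv (by split_ifs <;> omega) hab
        (ih b hba (hba.trans ha) hbv)
    by_cases hv5 : 5 ≤ v
    · rw [if_neg (by omega)] at step ⊢
      rcases lt_trichotomy a v with h | h | h
      · rcases Nat.eq_zero_or_pos a with rfl | h0
        · exact hrefl 0
        -- Below `v ≥ 5` the cycle joins `a - 1` to `a`; above `v`, the apex of `{a, v}` is itself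
        -- smaller than `a`.
        · have := hr (a - 1) (by omega) (by omega)
          have h2 : apex (a - 1) v = a := by
            rw [apex, min_eq_left (by omega), max_eq_right (by omega), apexAux, if_pos hv5,
              if_pos (by omega), Nat.sub_add_cancel h0]
          rw [h2] at this
          exact step _ (by omega) (by omega) (hsymm _ _ this)
      · exact absurd h hav
      · refine step _ ?_ ?_ (hr a ha hav) <;>
        · rw [apex, min_eq_right h.le, max_eq_left h.le, apexAux, if_pos (by omega)]
          split_ifs <;> omega
    · by_cases ha5 : 5 ≤ a
      · refine step _ ?_ ?_ (hr a ha hav) <;>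
        · rw [apex, min_eq_right (by omega), max_eq_left (by omega), apexAux, if_pos (by omega)]
          split_ifs <;> omega
      · have hne : ∀ b, b ≠ v → apex b v ≠ v := fun b hb => by
          rw [apex_comm]; exact apex_ne_left hb.symm
        -- Within the pentagon, `a ↦ apex a v` reaches the root in at most three steps.
        have hcycle : ∀ a < 5, ∀ v < 5, a ≠ v → (if v = 0 then 1 else 0) = a ∨
            (if v = 0 then 1 else 0) = apex a v ∨ (if v = 0 then 1 else 0) = apex (apex a v) v ∨
            (if v = 0 then 1 else 0) = apex (apex (apex a v) v) v := by decide
        have h1 := hr a ha hav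
        have l1 := apex_lt hn ha hv
        have n1 := hne a hav
        have h2 := hr _ l1 n1
        have l2 := apex_lt hn l1 hv
        have n2 := hne _ n1
        have h3 := hr _ l2 n2
        have l3 := apex_lt hn l2 hv
        have n3 := hne _ n2
        have h12 := htrans _ _ _ ha l1 l2 hav n1 n2 h1 h2
        rcases hcycle a (by omega) v (by omega) hav with h | h | h | h
        · rw [h]; exact hrefl a
        · rw [h]; exact h1
        · rw [h]; exact h12
        · rw [h]; exact htrans _ _ _ ha l2 l3 hav n2 n3 h12 h3
  exact htrans a _ b ha (by split_ifs <;> omega) hb hav (by split_ifs <;> omega) hbv (key a ha hav)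
    (hsymm _ _ (key b hb hbv))

/-- Induction on the largest vertex `c`. For `c ≥ 5` the cone triangles `{b, b + 1, c}` let `b` move
away from `a` one step at a time; in the pentagon every triangle already has an apex. -/
lemma apex_generates {z : ℕ → ℕ → ℕ → Prop} (hswap : ∀ a b c, z a b c → z b a c)
    (hswap' : ∀ a b c, z a b c → z a c b)
    (htet : ∀ a b c d, a < n → b < n → c < n → d < n → a ≠ b → a ≠ c → a ≠ d → b ≠ c → b ≠ d →
      c ≠ d → z a b c → z a b d → z a c d → z b c d)
    (hz : ∀ a b, a < n → b < n → a ≠ b → z a b (apex a b)) {a b c : ℕ} (hab : a < b) (hbc : b < c)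
    (hc : c < n) : z a b c := by
  induction c using Nat.strong_induction_on generalizing a b with
  | _ c ih =>
  by_cases h5 : 5 ≤ c
  · induction b, hab using Nat.le_induction with
    | base =>
      have h := hz a c (by omega) hc (by omega)
      rw [apex, min_eq_left (by omega), max_eq_right (by omega), apexAux, if_pos h5,
        if_pos (by omega)] at h
      exact hswap' _ _ _ h
    | succ b hb ihb =>
      have hb' : a < b := hb
      have h := hz b c (by omega) hc (by omega)
      rw [apex, min_eq_left (by omega), max_eq_right (by omega), apexAux, if_pos h5,
        if_pos (by omega)] at h
      -- In the tetrahedron `{a, b, b + 1, c}` the face without `c` is known from the outer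
      -- induction, `{a, b, c}` from the inner one, and `{b, b + 1, c}` has an apex.
      refine htet b a (b + 1) c (by omega) (by omega) (by omega) hc (by omega) (by omega)
        (by omega) (by omega) (by omega) (by omega) (hswap _ _ _ ?_) (hswap _ _ _ (ihb (by omega)))
        (hswap' _ _ _ h)
      exact ih (b + 1) hbc hb' (by omega) (by omega)
  · have hsmall : ∀ c < 5, ∀ b < c, ∀ a < b, apex a b = c ∨ apex a c = b ∨ apex b c = a := by
      decide
    rcases hsmall c (by omega) b hbc a hab with h | h | h
    · exact h ▸ hz a b (by omega) (by omega) (by omega)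
    · exact hswap' _ _ _ (h ▸ hz a c (by omega) (by omega) (by omega))
    · exact hswap _ _ _ (hswap' _ _ _ (h ▸ hz b c (by omega) (by omega) (by omega)))

end Apex

/-! ### The upper bound: syzygy modules are not free -/

section UpperBound

variable {K : Type*} [Field K] {n k : ℕ} {G : Type*} [AddCommGroup G]

/-- For `f ∉ S` the element `f - π f` is nonzero and killed by `π`; dividing a domain by a nonzero
element lowers the dimension. -/
lemma ringKrullDim_le_of_isGradedRetract {w : Fin n → G} {S : Subalgebra K (R K n)}
    (hS : IsGradedRetract w S) (hne : S ≠ ⊤) (hn : 1 ≤ n) :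
    ringKrullDim S ≤ ((n - 1 : ℕ) : WithBot ℕ∞) := by
  obtain ⟨π, -, hπS, hπ⟩ := hS
  obtain ⟨r, hr0, hr⟩ : ∃ r : R K n, r ≠ 0 ∧ π r = 0 := by
    by_contra! h
    refine hne (eq_top_iff.2 fun f _ => ?_)
    by_contra hf
    refine h (f - π f) (fun h0 => hf ?_) ?_
    · rw [sub_eq_zero.1 h0]
      exact hπS f
    · rw [map_sub, hπ _ (hπS f), sub_self]
  have h := ringKrullDim_succ_le_of_surjective (π.codRestrict S hπS : R K n →+* S)
    (fun s => ⟨s, Subtype.ext (hπ s s.2)⟩) (mem_nonZeroDivisors_of_ne_zero hr0) (Subtype.ext hr)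
  rw [MvPolynomial.ringKrullDim_of_isNoetherianRing, ringKrullDim_eq_zero_of_field, zero_add,
    Nat.card_eq_fintype_card, Fintype.card_fin] at h
  obtain ⟨m, rfl⟩ := Nat.exists_eq_add_of_le' hn
  rw [Nat.add_sub_cancel]
  rw [Nat.cast_add, Nat.cast_one] at h
  revert h
  generalize ringKrullDim S = d
  induction d with
  | bot => simp
  | coe d =>
    intro h
    have h' : d + 1 ≤ (m : ℕ∞) + 1 := by exact_mod_cast h
    exact_mod_cast (ENat.add_le_add_iff_right ENat.one_ne_top).1 h'

lemma coeff_single_mul_eq_zero {p q : R K n} (hp : coeff 0 p = 0) (hq : coeff 0 q = 0)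
    (i : Fin n) : coeff (Finsupp.single i 1) (p * q) = 0 := by
  rw [coeff_mul]
  refine Finset.sum_eq_zero fun x hx => ?_
  have h := congrArg Finsupp.degree (Finset.HasAntidiagonal.mem_antidiagonal.1 hx)
  rw [map_add, Finsupp.degree_single] at h
  rcases Nat.eq_zero_or_pos x.1.degree with h1 | h1
  · rw [(Finsupp.degree_eq_zero_iff _).1 h1, hp, zero_mul]
  · rw [(Finsupp.degree_eq_zero_iff _).1 (by omega : x.2.degree = 0), hq, mul_zero]

/-- Minimality of the Koszul complex: the differential has entries in the maximal ideal. -/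
lemma coeff_zero_repr_syzygy {x : Koszul K n} (hx : x ∈ syzygy K n k) (H : Finset (Fin n)) :
    coeff 0 ((Pi.basisFun (R K n) (Fin n)).ExteriorAlgebra.repr x H) = 0 := by
  rw [syzygy_eq_span] at hx
  induction hx using Submodule.span_induction with
  | mem x h =>
    obtain ⟨F, -, rfl⟩ := h
    have h := congrArg (coeff (expo H + 0)) (twist_koszulDifferential (K := K) F H)
    rw [twist_apply, coeff_monomial_mul, one_mul, add_zero, coeff_monomial] at h
    refine h.trans ?_
    split_ifs with hFH
    · rw [expo_injective hFH]
      refine boundary_eq_zero fun i hi hi' => ?_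
      rw [← hi'] at hi
      simp at hi
    · rfl
  | zero => simp
  | add x y _ _ hx hy => rw [map_add, Finsupp.add_apply, coeff_add, hx, hy, add_zero]
  | smul p x _ hx =>
    have h : constantCoeff ((Pi.basisFun (R K n) (Fin n)).ExteriorAlgebra.repr x H) = 0 := hx
    rw [map_smul, Finsupp.smul_apply, smul_eq_mul, ← constantCoeff_eq, map_mul, h, mul_zero]

/-- A syzygy module `M(n,k)` with `0 < k < n` is not free. -/
lemma exists_retract_ne_top {w : Fin n → G} (hk : 0 < k) (hkn : k < n)
    (D : StanleyDecomposition w (syzygyComponent K w k)) : ∃ i, D.S i ≠ ⊤ := by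
  by_contra! hS
  have huniq : ∀ s : Fin D.len → R K n, ∑ i, s i • D.x i = 0 → ∀ i, s i = 0 := by
    intro s hs i
    refine D.ann i _ (hS i ▸ Algebra.mem_top) ?_
    exact (iSupIndep_iff_finsetSum_eq_zero_imp_eq_zero _).1 D.isInternal.submodule_iSupIndep
      Finset.univ (fun i => s i • D.x i)
      (fun i _ => mem_stanleySpace.2 ⟨_, hS i ▸ Algebra.mem_top, rfl⟩) hs i (Finset.mem_univ i)
  have hex : ∀ y : syzygy K n k, ∃ s : Fin D.len → R K n, y = ∑ i, s i • D.x i := by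
    intro y
    have hy : y ∈ ⨆ i, stanleySpace (D.S i) (D.x i) := by
      rw [D.isInternal.submodule_iSup_eq_top]
      trivial
    induction hy using Submodule.iSup_induction' with
    | mem i y hy =>
      obtain ⟨s, -, rfl⟩ := mem_stanleySpace.1 hy
      refine ⟨Pi.single i s, ?_⟩
      rw [Finset.sum_eq_single i (fun j _ hj => by rw [Pi.single_eq_of_ne hj, zero_smul])
        (by simp), Pi.single_eq_same]
    | zero => exact ⟨0, by simp⟩
    | add x y _ _ hx hy =>
      obtain ⟨s, hs⟩ := hx
      obtain ⟨t, ht⟩ := hy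
      exact ⟨s + t, by simp only [Pi.add_apply, add_smul, Finset.sum_add_distrib, ← hs, ← ht]⟩
  obtain ⟨A, -, hA⟩ := Finset.exists_subset_card_eq
    (s := (Finset.univ : Finset (Fin n))) (n := k + 1) (by simpa using hkn)
  obtain ⟨a, ha⟩ : A.Nonempty := Finset.card_pos.1 (by omega)
  have hcard : ∀ i ∈ A, (A.erase i).card = k := fun i hi => by
    rw [Finset.card_erase_of_mem hi, hA, Nat.add_sub_cancel]
  have hs : ∀ i, ∃ s : Fin D.len → R K n, i ∈ A →
      koszulDifferential K n (koszulBasis K (A.erase i)) = ∑ j, s j • (D.x j : Koszul K n) := by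
    intro i
    by_cases hi : i ∈ A
    · obtain ⟨s, hs⟩ := hex ⟨_, koszulDifferential_mem_syzygy (hcard i hi)⟩
      refine ⟨s, fun _ => ?_⟩
      simpa using congrArg (Submodule.subtype _) hs
    · exact ⟨0, fun h => absurd h hi⟩
  choose s hs using hs
  obtain ⟨u, hu, -⟩ := exists_sum_boundary_eq_zero (K := K) A
  have hrel : ∀ j, ∑ i ∈ A, u i • (X i * s i j) = 0 := by
    refine huniq _ (Subtype.ext ?_)
    rw [Submodule.coe_zero, ← hu, Submodule.coe_sum]
    simp only [Submodule.coe_smul, Submodule.coe_sum, Finset.sum_smul]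
    rw [Finset.sum_comm]
    refine Finset.sum_congr rfl fun i hi => ?_
    rw [hs i hi, Finset.smul_sum, Finset.smul_sum]
    exact Finset.sum_congr rfl fun j _ => by
      rw [Units.smul_def, Units.smul_def, smul_assoc, mul_smul]
  -- Only the term `i = a` of the relation can contribute to the coefficient of `X a`. Hence `∂ e_{A
  -- \ a}` lies in the maximal ideal times the syzygy module.
  have hconst : ∀ j, coeff 0 (s a j) = 0 := by
    intro j
    have h := congrArg (coeff (Finsupp.single a 1)) (hrel j)
    rw [coeff_sum, Finset.sum_eq_single_of_mem a ha] at h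
    · rw [Units.smul_def, coeff_smul, coeff_X_mul', if_pos (by simp), tsub_self, coeff_zero,
        ← Units.smul_def, smul_eq_zero_iff_eq] at h
      exact h
    · intro i _ hia
      rw [Units.smul_def, coeff_smul, coeff_X_mul', if_neg (by simpa using hia), smul_zero]
  obtain ⟨b, hb⟩ : (A.erase a).Nonempty := Finset.card_pos.1 (by rw [hcard a ha]; exact hk)
  -- The coordinates of `∂ e_{A \ a}` would then have no linear terms, although the one at `e_{A \
  -- {a, b}}` is `± X b`.
  have h := congrArg (coeff (expo ((A.erase a).erase b) + Finsupp.single b 1))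
    (twist_koszulDifferential (K := K) (A.erase a) ((A.erase a).erase b))
  rw [twist_apply, coeff_monomial_mul, one_mul, coeff_monomial, if_pos
    (by rw [add_comm, expo_erase hb]), hs a ha, map_sum, Finsupp.finsetSum_apply, coeff_sum] at h
  refine boundary_erase_ne_zero hb (h.symm.trans (Finset.sum_eq_zero fun j _ => ?_))
  rw [map_smul, Finsupp.smul_apply, smul_eq_mul]
  exact coeff_single_mul_eq_zero (hconst j) (coeff_zero_repr_syzygy (D.x j).2 _) b

lemma stanleyDepth_syzygy_le (w : Fin n → G) (hk : 0 < k) (hkn : k < n) :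
    stanleyDepth w (syzygyComponent K w k) ≤ ((n - 1 : ℕ) : WithBot ℕ∞) := by
  refine iSup_le fun D => ?_
  obtain ⟨i, hi⟩ := exists_retract_ne_top hk hkn D
  exact (iInf_le _ i).trans
    (ringKrullDim_le_of_isGradedRetract (D.isGradedRetract i) hi (by omega))

end UpperBound

/-! ### Completing an independent family -/

section Completion

variable {K : Type*} [Field K] {n k : ℕ}

/-- A family of intervals and coefficient vectors which is independent in each squarefree degree
can be completed to a Stanley decomposition. The additional summands occur only in the degrees
in which the family does not span. -/
lemma exists_stanleyDecomposition_of_independent {G : Type*} [AddCommGroup G] (w : Fin n → G)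
    {α : Type*} [Fintype α] {F T : α → Finset (Fin n)} {ξ : α → Finset (Fin n) → K}
    (hξ : ∀ a, ξ a ∈ boundarySpan K k (F a))
    (hli : ∀ (A : Finset (Fin n)) (c : α → K), (∀ a, ¬(F a ⊆ A ∧ A ⊆ T a) → c a = 0) →
      ∑ a, c a • ξ a = 0 → c = 0)
    (hFT : ∀ a, F a ⊆ T a) :
    ∃ D : StanleyDecomposition w (syzygyComponent K w k), ∀ i,
      (∃ a, D.S i = MvPolynomial.supported K (T a : Set (Fin n))) ∨
      ∃ A : Finset (Fin n), D.S i = MvPolynomial.supported K (A : Set (Fin n)) ∧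
        ¬boundarySpan K k A ≤ Submodule.span K (ξ '' {a | F a ⊆ A ∧ A ⊆ T a}) := by
  classical
  have hW : ∀ A, Submodule.span K (ξ '' {a | F a ⊆ A ∧ A ⊆ T a}) ≤ boundarySpan K k A := by
    intro A
    rw [Submodule.span_le]
    rintro _ ⟨a, ⟨ha, -⟩, rfl⟩
    refine Submodule.span_mono (Set.image_mono ?_) (hξ a)
    exact fun H hH => ⟨hH.1, hH.2.trans ha⟩
  have hC : ∀ A, ∃ C : Submodule K (Finset (Fin n) → K),
      Disjoint (Submodule.span K (ξ '' {a | F a ⊆ A ∧ A ⊆ T a})) C ∧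
      Submodule.span K (ξ '' {a | F a ⊆ A ∧ A ⊆ T a}) ⊔ C = boundarySpan K k A := by
    intro A
    obtain ⟨C, hC⟩ := Submodule.exists_isCompl (Submodule.span K (ξ '' {a | F a ⊆ A ∧ A ⊆ T a}))
    refine ⟨C ⊓ boundarySpan K k A, hC.disjoint.mono_right inf_le_left, ?_⟩
    -- By the modular law, a complement in the whole space cuts down to a complement in
    -- `boundarySpan K k A`.
    rw [← sup_inf_assoc_of_le _ (hW A), hC.sup_eq_top, top_inf_eq]
  choose C hdisj hsup using hC
  let b := fun A => Module.finBasis K (C A)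
  -- A basis of each complement `C A` is added on the one-point interval `[A, A]`, so it is active
  -- at no other support.
  let ι := α ⊕ Σ A : Finset (Fin n), Fin (Module.finrank K (C A))
  let F' : ι → Finset (Fin n) := Sum.elim F Sigma.fst
  let T' : ι → Finset (Fin n) := Sum.elim T Sigma.fst
  let ξ' : ι → Finset (Fin n) → K := Sum.elim ξ fun p => (b p.1 p.2 : Finset (Fin n) → K)
  have hsum : ∀ (A : Finset (Fin n)) (c : ι → K),
      (∀ i, ¬(F' i ⊆ A ∧ A ⊆ T' i) → c i = 0) → ∑ i, c i • ξ' i =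
        ∑ a, c (Sum.inl a) • ξ a + ∑ j, c (Sum.inr ⟨A, j⟩) • (b A j : Finset (Fin n) → K) := by
    intro A c hc
    rw [Fintype.sum_sum_type, Fintype.sum_sigma]
    congr 1
    refine Finset.sum_eq_single A (fun A' _ hA' => Finset.sum_eq_zero fun j _ => ?_) (by simp)
    rw [hc (Sum.inr ⟨A', j⟩) fun h => hA' (Finset.Subset.antisymm h.1 h.2), zero_smul]
  have hmem : ∀ (A : Finset (Fin n)) (c : α → K), (∀ a, ¬(F a ⊆ A ∧ A ⊆ T a) → c a = 0) →
      ∑ a, c a • ξ a ∈ Submodule.span K (ξ '' {a | F a ⊆ A ∧ A ⊆ T a}) := by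
    intro A c hc
    refine sum_mem fun a _ => ?_
    by_cases ha : F a ⊆ A ∧ A ⊆ T a
    · exact Submodule.smul_mem _ _ (Submodule.subset_span ⟨a, ha, rfl⟩)
    · rw [hc a ha, zero_smul]
      exact zero_mem _
  have hspan : ∀ (A : Finset (Fin n)),
      ∀ y ∈ Submodule.span K (ξ '' {a | F a ⊆ A ∧ A ⊆ T a}),
      ∃ c : α → K, (∀ a, ¬(F a ⊆ A ∧ A ⊆ T a) → c a = 0) ∧ ∑ a, c a • ξ a = y := by
    intro A y hy
    induction hy using Submodule.span_induction with
    | mem y h =>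
      obtain ⟨a, ha, rfl⟩ := h
      refine ⟨Pi.single a 1, fun a' ha' => Pi.single_eq_of_ne (by rintro rfl; exact ha' ha) _, ?_⟩
      rw [Finset.sum_eq_single a (fun j _ hj => by rw [Pi.single_eq_of_ne hj, zero_smul])
        (by simp), Pi.single_eq_same, one_smul]
    | zero => exact ⟨0, fun _ _ => rfl, by simp⟩
    | add x y _ _ hx hy =>
      obtain ⟨c, hc, rfl⟩ := hx
      obtain ⟨d, hd, rfl⟩ := hy
      exact ⟨c + d, fun a ha => by rw [Pi.add_apply, hc a ha, hd a ha, add_zero],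
        by simp only [Pi.add_apply, add_smul, Finset.sum_add_distrib]⟩
    | smul r x _ hx =>
      obtain ⟨c, hc, rfl⟩ := hx
      exact ⟨r • c, fun a ha => by rw [Pi.smul_apply, hc a ha, smul_zero],
        by simp only [Pi.smul_apply, smul_assoc, Finset.smul_sum]⟩
  obtain ⟨D, hD⟩ : ∃ D : StanleyDecomposition w (syzygyComponent K w k),
      ∀ i, ∃ j, D.S i = MvPolynomial.supported K (T' j : Set (Fin n)) := by
    refine exists_stanleyDecomposition (F := F') (T := T') (ξ := ξ') w ?_ ?_ ?_ ?_
    · rintro (a | ⟨A, j⟩)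
      · exact hξ a
      · exact ((le_sup_right.trans (hsup A).le : C A ≤ _)) (b A j).2
    · intro A c hc h0
      rw [hsum A c hc] at h0
      have h1 := hmem A (fun a => c (Sum.inl a)) fun a ha => hc (Sum.inl a) ha
      have h2 : ∑ j, c (Sum.inr ⟨A, j⟩) • (b A j : Finset (Fin n) → K) ∈ C A :=
        sum_mem fun j _ => Submodule.smul_mem _ _ (b A j).2
      have h3 : ∑ a, c (Sum.inl a) • ξ a = 0 := by
        refine Submodule.disjoint_def.1 (hdisj A) _ h1 ?_
        rw [eq_neg_of_add_eq_zero_left h0]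
        exact neg_mem h2
      have h4 := hli A (fun a => c (Sum.inl a)) (fun a ha => hc (Sum.inl a) ha) h3
      rw [h3, zero_add] at h0
      have h5 : ∀ j, c (Sum.inr ⟨A, j⟩) = 0 := by
        refine Fintype.linearIndependent_iff.1 (b A).linearIndependent _ (Subtype.ext ?_)
        rw [Submodule.coe_sum]
        exact h0
      funext i
      rcases i with a | ⟨A', j⟩
      · exact congrFun h4 a
      · by_cases hA : A' = A
        · subst hA
          exact h5 j
        · exact hc _ fun h => hA (Finset.Subset.antisymm h.1 h.2)
    · intro A H hH hHA
      have h : boundary K H ∈ boundarySpan K k A := Submodule.subset_span ⟨H, ⟨hH, hHA⟩, rfl⟩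
      rw [← hsup, Submodule.mem_sup] at h
      obtain ⟨y, hy, z, hz, hyz⟩ := h
      obtain ⟨c, hc, hcy⟩ := hspan A y hy
      refine ⟨Sum.elim c fun p => if h : p.1 = A then (b A).repr ⟨z, hz⟩ (h ▸ p.2) else 0, ?_, ?_⟩
      · rintro (a | ⟨A', j⟩) hi
        · exact hc a hi
        · exact dif_neg fun h => hi (by subst h; exact ⟨subset_rfl, subset_rfl⟩)
      · rw [hsum A, ← hyz, ← hcy]
        · congr 1
          have := congrArg (Submodule.subtype _) ((b A).sum_repr ⟨z, hz⟩)
          rw [map_sum] at this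
          simpa using this.symm
        · rintro (a | ⟨A', j⟩) hi
          · exact hc a hi
          · exact dif_neg fun h => hi (by subst h; exact ⟨subset_rfl, subset_rfl⟩)
    · rintro (a | ⟨A, j⟩)
      · exact hFT a
      · exact subset_rfl
  refine ⟨D, fun i => ?_⟩
  obtain ⟨a | ⟨A, j⟩, hj⟩ := hD i
  · exact Or.inl ⟨a, hj⟩
  · refine Or.inr ⟨A, hj, fun hle => ?_⟩
    have h0 : C A = ⊥ := by
      have := (hdisj A).mono_left ((le_sup_right.trans (hsup A).le).trans hle)
      exact disjoint_self.1 this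
    have hj0 := j.pos
    rw [h0, finrank_bot] at hj0
    exact absurd hj0 (lt_irrefl 0)

end Completion

/-! ### Generating all triangles from the initial ones -/

section Selection

variable {n : ℕ}

/-- The apex of a triangle, as a set with at most one element. -/
def top (T : Finset (Fin n)) : Finset (Fin n) :=
  T.filter fun v => ∃ x ∈ T, ∃ y ∈ T, x ≠ y ∧ x ≠ v ∧ y ≠ v ∧ apex x y = v

lemma top_subset (T : Finset (Fin n)) : top T ⊆ T := Finset.filter_subset _ _

lemma mem_top_insert {x y v : Fin n} (hxy : x ≠ y) (hxv : x ≠ v) (hyv : y ≠ v) :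
    v ∈ top {x, y, v} ↔ apex x y = v := by
  simp only [top, Finset.mem_filter, Finset.mem_insert, Finset.mem_singleton]
  constructor
  · rintro ⟨-, x', hx', y', hy', h1, h2, h3, h⟩
    rcases hx' with rfl | rfl | rfl <;> rcases hy' with rfl | rfl | rfl <;>
      first | exact absurd rfl h1 | exact absurd rfl h2 | exact absurd rfl h3 | exact h |
        (rw [apex_comm]; exact h)
  · intro h
    exact ⟨by simp, x, by simp, y, by simp, hxy, hxv, hyv, h⟩

lemma card_top_le {T : Finset (Fin n)} (hT : T.card = 3) : (top T).card ≤ 1 := by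
  refine Finset.card_le_one.2 fun v hv v' hv' => ?_
  by_contra hne
  have h1 := top_subset T hv
  have h2 := top_subset T hv'
  have : ((T.erase v).erase v').card = 1 := by
    rw [Finset.card_erase_of_mem (Finset.mem_erase.2 ⟨Ne.symm hne, h2⟩),
      Finset.card_erase_of_mem h1, hT]
  obtain ⟨y, hy⟩ := Finset.card_eq_one.1 this
  have hy' : y ∈ (T.erase v).erase v' := by rw [hy]; simp
  rw [Finset.mem_erase, Finset.mem_erase] at hy'
  have hT' : T = {y, v', v} := by
    rw [← Finset.insert_erase h1, ← Finset.insert_erase (Finset.mem_erase.2 ⟨Ne.symm hne, h2⟩), hy]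
    ext z
    simp only [Finset.mem_insert, Finset.mem_singleton]
    tauto
  have hT'' : T = {y, v, v'} := by
    rw [hT', Finset.pair_comm]
  rw [hT', mem_top_insert hy'.1 hy'.2.1 (Ne.symm hne)] at hv
  rw [hT'', mem_top_insert hy'.2.1 hy'.1 hne] at hv'
  exact apex_inj (fun h => hne (Fin.ext h.symm)) hv hv'

/-- The triangles `T` that do not contain `D`, or whose apex is not in `D`, generate all triangles
if the fourth face of a tetrahedron may be added as soon as the other three are present. -/
lemma triangle_induction (hn : 5 ≤ n) {Z : Finset (Fin n) → Prop} {D : Finset (Fin n)}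
    (hZ : ∀ T : Finset (Fin n), T.card = 3 → ¬(D ⊆ T ∧ top T ⊆ D) → Z T)
    (htet : ∀ a b c d : Fin n, a ≠ b → a ≠ c → a ≠ d → b ≠ c → b ≠ d → c ≠ d →
      Z {a, b, c} → Z {a, b, d} → Z {a, c, d} → Z {b, c, d})
    {T : Finset (Fin n)} (hT : T.card = 3) : Z T := by
  by_cases hDT : D ⊆ T
  swap
  · exact hZ T hT fun h => hDT h.1
  have hnot : ∀ {a b c : Fin n}, a ≠ b → a ≠ c → b ≠ c → ∀ e ∈ D, e ≠ a → e ≠ b → e ≠ c →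
      Z {a, b, c} := fun {a b c} hab hac hbc e he ha hb hc =>
    hZ _ (Finset.card_eq_three.2 ⟨a, b, c, hab, hac, hbc, rfl⟩) fun h => by
      simpa [ha, hb, hc] using h.1 he
  have hfill : ∀ x y v : Fin n, x ≠ y → v ∉ D → apex x y = v → Z {x, y, v} := by
    intro x y v hxy hv h
    have hxv : x ≠ v := fun hxv => apex_ne_left (Fin.val_ne_of_ne hxy) (h.trans (by rw [hxv]))
    have hyv : y ≠ v := fun hyv => apex_ne_left (Fin.val_ne_of_ne hxy).symm
      ((apex_comm _ _).trans (h.trans (by rw [hyv])))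
    refine hZ _ (Finset.card_eq_three.2 ⟨x, y, v, hxy, hxv, hyv, rfl⟩) fun h' => hv (h'.2 ?_)
    exact (mem_top_insert hxy hxv hyv).2 h
  -- `Z` is transported to natural numbers, where `apex` is defined; arguments outside the vertex
  -- range are harmless.
  let z : ℕ → ℕ → ℕ → Prop := fun a b c =>
    Z (Finset.univ.filter fun i : Fin n => (i : ℕ) = a ∨ (i : ℕ) = b ∨ (i : ℕ) = c)
  have hz : ∀ x y v : Fin n, z x y v ↔ Z {x, y, v} := by
    intro x y v
    have : (Finset.univ.filter fun i : Fin n => (i : ℕ) = x ∨ (i : ℕ) = y ∨ (i : ℕ) = v) =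
        {x, y, v} := by
      ext i
      simp [Fin.ext_iff]
    simp only [z, this]
  have hswap : ∀ a b c, z a b c → z b a c := by
    intro a b c h
    simpa only [z, or_left_comm] using h
  have hswap' : ∀ a b c, z a b c → z a c b := by
    intro a b c h
    simpa only [z, or_comm] using h
  have hztet : ∀ a b c d, a < n → b < n → c < n → d < n → a ≠ b → a ≠ c → a ≠ d → b ≠ c →
      b ≠ d → c ≠ d → z a b c → z a b d → z a c d → z b c d := by
    intro a b c d ha hb hc hd h1 h2 h3 h4 h5 h6 h7 h8 h9
    exact (hz ⟨b, hb⟩ ⟨c, hc⟩ ⟨d, hd⟩).2 (htet ⟨a, ha⟩ _ _ _ (by simpa using h1) (by simpa using h2)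
      (by simpa using h3) (by simpa using h4) (by simpa using h5) (by simpa using h6)
      ((hz ⟨a, ha⟩ ⟨b, hb⟩ ⟨c, hc⟩).1 h7) ((hz ⟨a, ha⟩ ⟨b, hb⟩ ⟨d, hd⟩).1 h8)
      ((hz ⟨a, ha⟩ ⟨c, hc⟩ ⟨d, hd⟩).1 h9))
  have hzfill : ∀ a b (ha : a < n) (hb : b < n), a ≠ b →
      (⟨apex a b, apex_lt hn ha hb⟩ : Fin n) ∉ D → z a b (apex a b) := fun a b ha hb hab h =>
    (hz ⟨a, ha⟩ ⟨b, hb⟩ ⟨apex a b, apex_lt hn ha hb⟩).2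
      (hfill _ _ _ (by simpa using hab) h rfl)
  have hcard := Finset.card_le_card hDT
  rw [hT] at hcard
  obtain h0 | h0 | h0 | h0 : D.card = 0 ∨ D.card = 1 ∨ D.card = 2 ∨ D.card = 3 := by omega
  · -- all triangles with an apex are present
    rw [Finset.card_eq_zero] at h0
    subst h0
    have G : ∀ {a b c : ℕ}, a < b → b < c → c < n → z a b c := fun h1 h2 h3 =>
      apex_generates hswap hswap' hztet (fun a b ha hb hab => hzfill a b ha hb hab (by simp))
        h1 h2 h3
    obtain ⟨x, y, v, hxy, hxv, hyv, rfl⟩ := Finset.card_eq_three.1 hT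
    rw [← hz]
    rcases lt_or_gt_of_ne (Fin.val_ne_of_ne hxy) with h1 | h1 <;>
    rcases lt_or_gt_of_ne (Fin.val_ne_of_ne hxv) with h2 | h2 <;>
    rcases lt_or_gt_of_ne (Fin.val_ne_of_ne hyv) with h3 | h3 <;>
    first
    | exact G h1 h3 v.2
    | exact hswap' _ _ _ (G h2 h3 y.2)
    | exact hswap _ _ _ (G h1 h2 v.2)
    | exact hswap _ _ _ (hswap' _ _ _ (G h3 h2 x.2))
    | exact hswap' _ _ _ (hswap _ _ _ (G h2 h1 y.2))
    | exact hswap _ _ _ (hswap' _ _ _ (hswap _ _ _ (G h3 h1 x.2)))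
  · -- the triangles containing a given vertex
    obtain ⟨v, rfl⟩ := Finset.card_eq_one.1 h0
    rw [Finset.singleton_subset_iff] at hDT
    obtain ⟨x, y, hxy, hxy'⟩ := Finset.card_eq_two.1
      (by rw [Finset.card_erase_of_mem hDT, hT] : (T.erase v).card = 2)
    have hx : x ∈ T.erase v := by rw [hxy']; simp
    have hy : y ∈ T.erase v := by rw [hxy']; simp
    rw [Finset.mem_erase] at hx hy
    -- In the link of `v`, adjacency is transitive: the tetrahedron `{a, b, c, v}` has the face `{a,
    -- b, c}`, which avoids `v` and is present from the start.
    have hr := apex_connected (r := fun a b => a = b ∨ z a b v) hn v.2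
      (fun a b => Or.imp Eq.symm (hswap _ _ _)) (fun a => Or.inl rfl) ?_
      (fun a ha hav => Or.inr ?_) x.2 y.2 (Fin.val_ne_of_ne hx.1) (Fin.val_ne_of_ne hy.1)
    · rw [← Finset.insert_erase hDT, hxy', ← hz]
      rcases hr with hr | hr
      · exact absurd (Fin.ext hr) hxy
      · exact hswap _ _ _ (hswap' _ _ _ hr)
    · intro a b c ha hb hc hav hbv hcv hab hbc
      by_cases hac : a = c
      · exact Or.inl hac
      rcases hab with rfl | hab
      · exact hbc
      rcases hbc with rfl | hbc
      · exact Or.inr hab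
      by_cases hab' : a = b
      · exact Or.inr (hab' ▸ hbc)
      by_cases hbc' : b = c
      · exact Or.inr (hbc' ▸ hab)
      refine Or.inr (hztet b a c v hb ha hc v.2 (Ne.symm hab') hbc' hbv hac hav hcv ?_
        (hswap _ _ _ hab) hbc)
      refine (hz ⟨b, hb⟩ ⟨a, ha⟩ ⟨c, hc⟩).2 (hnot (fun h => hab' (congrArg Fin.val h).symm)
        (fun h => hbc' (congrArg Fin.val h)) (fun h => hac (congrArg Fin.val h)) v (by simp) ?_ ?_ ?_)
      · exact fun h => hbv (congrArg Fin.val h).symm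
      · exact fun h => hav (congrArg Fin.val h).symm
      · exact fun h => hcv (congrArg Fin.val h).symm
    · have h1 : apex a v ≠ a := apex_ne_left hav
      have h2 : apex a v ≠ v := by rw [apex_comm]; exact apex_ne_left (Ne.symm hav)
      refine hswap' _ _ _ (hzfill a v ha v.2 hav ?_)
      rw [Finset.mem_singleton]
      exact fun h => h2 (congrArg Fin.val h)
  · -- the triangles containing a given edge
    obtain ⟨x, y, hxy, rfl⟩ := Finset.card_eq_two.1 h0
    obtain ⟨v, hv⟩ := Finset.card_eq_one.1
      (by rw [Finset.card_sdiff_of_subset hDT, hT, h0] : (T \ {x, y}).card = 1)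
    have hv' : v ∈ T \ {x, y} := by rw [hv]; simp
    simp only [Finset.mem_sdiff, Finset.mem_insert, Finset.mem_singleton, not_or] at hv'
    have hT' : T = {v, x, y} := by
      rw [← Finset.sdiff_union_of_subset hDT, hv]
      rfl
    -- The triangle on `{x, y}` with its apex is present; any other `{v, x, y}` follows from the
    -- tetrahedron `{w, v, x, y}`, whose other two faces do not contain the edge.
    let w : Fin n := ⟨apex x y, apex_lt hn x.2 y.2⟩
    have hwx : w ≠ x := fun h => apex_ne_left (Fin.val_ne_of_ne hxy) (congrArg Fin.val h)
    have hwy : w ≠ y := fun h => apex_ne_left (Fin.val_ne_of_ne hxy).symm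
      ((apex_comm _ _).trans (congrArg Fin.val h))
    have hw : Z {w, x, y} := by
      have := hfill x y w hxy (by simp [hwx, hwy]) rfl
      convert this using 1
      ext; simp; tauto
    rw [hT']
    by_cases hwv : w = v
    · rw [← hwv]; exact hw
    · exact htet w v x y hwv hwx hwy hv'.2.1 hv'.2.2 hxy
        (hnot hwv hwx hv'.2.1 y (by simp) (Ne.symm hwy) (Ne.symm hv'.2.2) hxy.symm)
        (hnot hwv hwy hv'.2.2 x (by simp) (Ne.symm hwx) (Ne.symm hv'.2.1) hxy) hw
  · have := Finset.eq_of_subset_of_card_le hDT (by omega)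
    subst this
    obtain ⟨b, c, d, hbc, hbd, hcd, rfl⟩ := Finset.card_eq_three.1 hT
    -- Only the triangle `D` itself can be missing; it is a face of a tetrahedron whose other faces
    -- do not contain `D`.
    obtain ⟨a, ha⟩ : ∃ a, a ∉ ({b, c, d} : Finset (Fin n)) := by
      by_contra! h
      have := Finset.card_le_card (fun x _ => h x : Finset.univ ⊆ ({b, c, d} : Finset (Fin n)))
      rw [hT, Finset.card_univ, Fintype.card_fin] at this
      omega
    simp only [Finset.mem_insert, Finset.mem_singleton, not_or] at ha
    exact htet a b c d ha.1 ha.2.1 ha.2.2 hbc hbd hcd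
      (hnot ha.1 ha.2.1 hbc d (by simp) (Ne.symm ha.2.2) hbd.symm hcd.symm)
      (hnot ha.1 ha.2.2 hbd c (by simp) (Ne.symm ha.2.1) hbc.symm hcd)
      (hnot ha.2.1 ha.2.2 hcd b (by simp) (Ne.symm ha.1) hbc hbd)

end Selection

/-! ### The lower bound and the Stanley depth -/

section Main

variable {K : Type*} [Field K] {n : ℕ}

/-- `triangle_induction` with `D = Aᶜ`, where `Z T` says that the coefficient of `Tᶜ` is zero. -/
lemma eq_zero_of_sum_boundary_eq_zero (hn : 5 ≤ n) (A : Finset (Fin n))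
    (c : {H : Finset (Fin n) // H.card = n - 3} → K)
    (hc : ∀ H : {H : Finset (Fin n) // H.card = n - 3},
      ¬((H : Finset (Fin n)) ⊆ A ∧ A ⊆ (top (H : Finset (Fin n))ᶜ)ᶜ) → c H = 0)
    (h0 : ∑ H, c H • boundary K (H : Finset (Fin n)) = 0) : c = 0 := by
  have key : ∀ T : Finset (Fin n), T.card = 3 → ∀ hT : Tᶜ.card = n - 3, c ⟨Tᶜ, hT⟩ = 0 := by
    intro T hT3
    refine triangle_induction hn (D := Aᶜ)
      (Z := fun T => ∀ hT : Tᶜ.card = n - 3, c ⟨Tᶜ, hT⟩ = 0) ?_ ?_ hT3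
    · intro T hT h hT'
      refine hc _ fun h' => h ?_
      simp only [compl_compl] at h'
      exact ⟨compl_le_iff_compl_le.1 h'.1,
        by rw [Finset.subset_compl_comm]; exact h'.2⟩
    · intro a b d e hab had hae hbd hbe hde h1 h2 h3 hT
      -- The sets `H` with a nonzero entry at this coordinate are the complements of the four faces
      -- of `{a, b, d, e}`.
      have h := congrFun h0 ({a, b, d, e} : Finset (Fin n))ᶜ
      have ha : a ∈ ({b, d, e} : Finset (Fin n))ᶜ := by simp [hab, had, hae]
      have hQ : ({a, b, d, e} : Finset (Fin n))ᶜ = ({b, d, e} : Finset (Fin n))ᶜ.erase a := by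
        ext i; simp
      rw [Finset.sum_apply, Finset.sum_eq_single_of_mem ⟨({b, d, e} : Finset (Fin n))ᶜ, hT⟩
        (Finset.mem_univ _), Pi.smul_apply, smul_eq_mul, Pi.zero_apply] at h
      · refine (mul_eq_zero.1 h).resolve_right ?_
        rw [hQ]
        exact boundary_erase_ne_zero ha
      · rintro ⟨H, hH⟩ - hne
        rw [Pi.smul_apply, smul_eq_mul]
        by_contra hne0
        have hb : boundary K H ({a, b, d, e} : Finset (Fin n))ᶜ ≠ 0 := right_ne_zero_of_mul hne0
        obtain ⟨i, hi, hHi⟩ : ∃ i ∈ H, H.erase i = ({a, b, d, e} : Finset (Fin n))ᶜ := by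
          by_contra! h
          exact hb (boundary_eq_zero h)
        have hiQ : i ∈ ({a, b, d, e} : Finset (Fin n)) := by
          rw [← Finset.notMem_compl, ← hHi]
          simp
        have hH' : H = (({a, b, d, e} : Finset (Fin n)).erase i)ᶜ := by
          rw [Finset.compl_erase, ← hHi, Finset.insert_erase hi]
        have hc0 : c ⟨H, hH⟩ ≠ 0 := left_ne_zero_of_mul hne0
        subst hH'
        simp only [Finset.mem_insert, Finset.mem_singleton] at hiQ
        rcases hiQ with rfl | rfl | rfl | rfl
        · refine hne (Subtype.ext (congrArg compl ?_))
          exact Finset.erase_insert (by simp [hab, had, hae])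
        · refine hc0 ?_
          have : ({a, i, d, e} : Finset (Fin n)).erase i = {a, d, e} := by
            ext j; simp; grind
          simp only [this] at hH ⊢
          exact h3 hH
        · refine hc0 ?_
          have : ({a, b, i, e} : Finset (Fin n)).erase i = {a, b, e} := by
            ext j; simp; grind
          simp only [this] at hH ⊢
          exact h2 hH
        · refine hc0 ?_
          have : ({a, b, d, i} : Finset (Fin n)).erase i = {a, b, d} := by
            ext j; simp; grind
          simp only [this] at hH ⊢
          exact h1 hH
  funext ⟨H, hH⟩
  have h := key Hᶜ (by rw [Finset.card_compl, Fintype.card_fin, hH]; omega)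
  simp only [compl_compl] at h
  exact h hH

/-- Only `|A| = n - 3` and `|A| = n - 2` matter. In the first case `H = A` is active, since its apex
lies in `Aᶜ`. In the second, `Aᶜ = {x, y}` and only `A \ {apex x y}` can fail to be active; the
relation `∂² e_A = 0` expresses its boundary through the others. -/
lemma boundarySpan_le (hn : 5 ≤ n) {A : Finset (Fin n)} (hA : A.card + 2 ≤ n) :
    boundarySpan K (n - 3) A ≤ Submodule.span K
      ((fun H : {H : Finset (Fin n) // H.card = n - 3} => boundary K (H : Finset (Fin n))) ''
        {H | (H : Finset (Fin n)) ⊆ A ∧ A ⊆ (top (H : Finset (Fin n))ᶜ)ᶜ}) := by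
  have hmem : ∀ H : Finset (Fin n), H.card = n - 3 → H ⊆ A → top Hᶜ ⊆ Aᶜ →
      boundary K H ∈ Submodule.span K
      ((fun H : {H : Finset (Fin n) // H.card = n - 3} => boundary K (H : Finset (Fin n))) ''
        {H | (H : Finset (Fin n)) ⊆ A ∧ A ⊆ (top (H : Finset (Fin n))ᶜ)ᶜ}) :=
    fun H hH hHA htop => Submodule.subset_span
      ⟨⟨H, hH⟩, ⟨hHA, by rw [Finset.subset_compl_comm]; exact htop⟩, rfl⟩
  rw [boundarySpan, Submodule.span_le]
  rintro _ ⟨H, ⟨hH, hHA⟩, rfl⟩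
  rw [SetLike.mem_coe]
  by_cases htop : top Hᶜ ⊆ Aᶜ
  · exact hmem H hH hHA htop
  have hle := Finset.card_le_card hHA
  have hcard : (A \ H).card = 1 := by
    rw [Finset.card_sdiff_of_subset hHA]
    by_contra hne
    have : H = A := Finset.eq_of_subset_of_card_le hHA (by omega)
    subst this
    exact htop (top_subset _)
  obtain ⟨v, hv⟩ := Finset.card_eq_one.1 hcard
  have hvm : v ∈ A \ H := by rw [hv]; simp
  rw [Finset.mem_sdiff] at hvm
  have hHv : H = A.erase v := by
    rw [← Finset.sdiff_singleton_eq_erase, ← hv, Finset.sdiff_sdiff_eq_self hHA]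
  have hAc : Aᶜ.card = 2 := by
    rw [Finset.card_sdiff_of_subset hHA] at hcard
    rw [Finset.card_compl, Fintype.card_fin]
    omega
  obtain ⟨x, y, hxy, hD⟩ := Finset.card_eq_two.1 hAc
  have hAn : ∀ i ∈ A, i ≠ x ∧ i ≠ y := by
    intro i hi
    have : i ∉ Aᶜ := by simpa using hi
    simpa [hD] using this
  have hcompl : ∀ i, (A.erase i)ᶜ = {x, y, i} := by
    intro i
    rw [Finset.compl_erase, hD]
    ext j; simp; tauto
  have htop' : ∀ i ∈ A, top (A.erase i)ᶜ ⊆ Aᶜ ↔ apex x y ≠ i := by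
    intro i hi
    have hm := mem_top_insert hxy (Ne.symm (hAn i hi).1) (Ne.symm (hAn i hi).2)
    rw [hcompl, ne_eq, ← hm]
    constructor
    · intro h h'
      have := h h'
      rw [Finset.mem_compl] at this
      exact this hi
    · intro h j hj
      have hj' := top_subset _ hj
      simp only [Finset.mem_insert, Finset.mem_singleton] at hj'
      rw [hD, Finset.mem_insert, Finset.mem_singleton]
      rcases hj' with h' | h' | h'
      · exact Or.inl h'
      · exact Or.inr h'
      · exact absurd (h' ▸ hj) h
  rw [hHv, htop' v hvm.1, not_not] at htop
  obtain ⟨u, -, hu⟩ := exists_sum_boundary_eq_zero (K := K) A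
  rw [← Finset.add_sum_erase A _ hvm.1] at hu
  have hu0 : (((u v : ℤˣ) : ℤ) : K) ≠ 0 := ((u v).isUnit.map (Int.castRingHom K)).ne_zero
  rw [hHv, ← Submodule.smul_mem_iff _ hu0, eq_neg_of_add_eq_zero_left hu]
  refine neg_mem (sum_mem fun i hi => Submodule.smul_mem _ _ ?_)
  rw [Finset.mem_erase] at hi
  refine hmem _ ?_ (Finset.erase_subset _ _) ((htop' i hi.2).2 ?_)
  · rw [Finset.card_erase_of_mem hi.2, ← Finset.card_erase_of_mem hvm.1, ← hHv, hH]
  · rw [htop]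
    exact fun h => hi.1 (Fin.ext h.symm)

lemma le_stanleyDepth_syzygy {G : Type*} [AddCommGroup G] (w : Fin n → G) (hn : 5 ≤ n) :
    ((n - 1 : ℕ) : WithBot ℕ∞) ≤ stanleyDepth w (syzygyComponent K w (n - 3)) := by
  obtain ⟨D, hD⟩ := exists_stanleyDecomposition_of_independent (K := K) (k := n - 3) w
    (α := {H : Finset (Fin n) // H.card = n - 3}) (F := Subtype.val)
    (T := fun H => (top (H : Finset (Fin n))ᶜ)ᶜ) (ξ := fun H => boundary K (H : Finset (Fin n)))
    (fun H => Submodule.subset_span ⟨H, ⟨H.2, subset_rfl⟩, rfl⟩)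
    (eq_zero_of_sum_boundary_eq_zero hn)
    (fun H => by rw [Finset.subset_compl_comm]; exact top_subset _)
  refine le_iSup_of_le D (le_iInf fun i => ?_)
  rcases hD i with ⟨⟨H, hH⟩, hi⟩ | ⟨A, hi, hA⟩
  · rw [hi, ringKrullDim_supported, Finset.card_compl, Fintype.card_fin]
    have := card_top_le (T := Hᶜ) (by rw [Finset.card_compl, Fintype.card_fin, hH]; omega)
    exact_mod_cast Nat.sub_le_sub_left this n
  · rw [hi, ringKrullDim_supported]
    -- Added summands occur only where the family fails to span, hence only for `|A| ≥ n - 1`.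
    have : ¬A.card + 2 ≤ n := fun h => hA (boundarySpan_le hn h)
    exact_mod_cast (by omega : n - 1 ≤ A.card)

lemma stanleyDepth_syzygy {G : Type*} [AddCommGroup G] (w : Fin n → G) (hn : 5 ≤ n) :
    stanleyDepth w (syzygyComponent K w (n - 3)) = ((n - 1 : ℕ) : WithBot ℕ∞) :=
  le_antisymm (stanleyDepth_syzygy_le w (by omega) (by omega)) (le_stanleyDepth_syzygy w hn)

end Main

end StanleyDepth

theorem mainTheorem8 (K : Type*) [Field K] (n : ℕ) (hn : 5 ≤ n) :
    StanleyDepth.stanleyDepth (StanleyDepth.multiWeight n)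
        (StanleyDepth.syzygyComponent K (StanleyDepth.multiWeight n) (n - 3))
      = ((n - 1 : ℕ) : WithBot ℕ∞) ∧
    StanleyDepth.stanleyDepth (StanleyDepth.stdWeight n)
        (StanleyDepth.syzygyComponent K (StanleyDepth.stdWeight n) (n - 3))
      = ((n - 1 : ℕ) : WithBot ℕ∞) :=
  ⟨StanleyDepth.stanleyDepth_syzygy _ hn, StanleyDepth.stanleyDepth_syzygy _ hn⟩
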